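/- Let $\mathbb N=\{1,2,\dots\}$ and let $P$ be a countable Köthe set on $\mathbb N$, i.e. a countable set of nonnegative sequences $p=(p_n)$ such that for each $n$ some $p\in P$ has $p_n>0$, and for all $p,q\in P$ there is $r\in P$ with $\max\{p_n,q_n\}\le r_n$ for all $n$. Let $$A=\lambda(P)=\Bigl\{x\in\mathbb C^{\mathbb N}:\ \|x\|_p=\sum_n|x_n|p_n<\infty\ \text{ for all }p\in P\Bigr\}$$ with the topology given by the seminorms $\|\cdot\|_p$, $p\in P$. For sets $Q,R$ of nonnegative sequences write $Q\prec R$ if for each $q\in Q$ there are $r\in R$ and $C>0$ with $q_n\le Cr_n$ for all $n$, and let $P^2=\{pq: p,q\in P\}$ (pointwise products). Suppose that $P\prec P^2$, so that $A$ is an algebra under pointwise multiplication (a Köthe algebra), that $P$ satisfies condition (B), i.e. $P\prec P^2$ and $P^2\prec P$, and that $1\le p_n\le p_{n+1}$ for all $p\in P$ and $n\in\mathbb N$. Then the following conditions are equivalent: (i) $A$ is a nuclear locally convex space; (ii) the Köthe–Toeplitz dual $A^\times=\{y\in\mathbb C^{\mathbb N}:\ \|y\|_x=\sum_n|y_nx_n|<\infty\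 \text{ for all }x\in A\}$, with the topology given by the seminorms $\|\cdot\|_x$, $x\in A$, is nuclear; (iii) $A=A^2$, where $A^2$ is the linear span of $\{ab: a,b\in A\}$; (iv) there is $p\in P$ such that $p_n>1$ for all but finitely many $n$ and $$\sup_{n:\,p_n>1}\frac{\log n}{\log p_n}<\infty .$$ Each of these conditions implies that $A$ is approximately contractible, i.e. that for each Fréchet $A$-bimodule $X$ (a Fréchet space with commuting, associative, jointly continuous left and right actions of $A$), every continuous derivation $A\to X$ is the limit, pointwise on $A$, of a net of inner derivations $a\mapsto a\cdot x-x\cdot a$. -/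

import Mathlib

open scoped NNReal Topology Pointwise

universe u v w

namespace Kothe

/-! ### Nuclear maps and nuclear spaces -/

section Nuclear

/-- A continuous linear map between Banach spaces is nuclear if it can be written as
`T x = ∑ n, f n x • y n` with `∑ n, ‖f n‖ * ‖y n‖ < ∞`. -/
def IsNuclearMap {X Y : Type*} [NormedAddCommGroup X] [NormedSpace ℂ X]
    [NormedAddCommGroup Y] [NormedSpace ℂ Y] (T : X →L[ℂ] Y) : Prop :=
  ∃ (f : ℕ → X →L[ℂ] ℂ) (y : ℕ → Y),
    Summable (fun n => ‖f n‖ * ‖y n‖) ∧ ∀ x, HasSum (fun n => f n x • y n) (T x)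

variable {E : Type*} [AddCommGroup E] [Module ℂ E]

/-- The vector space `E` regarded as a seminormed space with the seminorm `p`. -/
def LocalSpace (_p : Seminorm ℂ E) : Type _ := E

noncomputable instance (p : Seminorm ℂ E) : SeminormedAddCommGroup (LocalSpace p) :=
  p.toSeminormedAddCommGroup

noncomputable instance (p : Seminorm ℂ E) : NormedSpace ℂ (LocalSpace p) where
  toModule := inferInstanceAs (Module ℂ E)
  norm_smul_le a x := (map_smul_eq_mul p a x).le

/-- The local Banach space of `E` at the seminorm `p`: the completion of `E / ker p` with respect
to the norm induced by `p` (the completion is automatically separated). -/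
abbrev LocalBanach (p : Seminorm ℂ E) : Type _ := UniformSpace.Completion (LocalSpace p)

/-- For `p ≤ q`, the identity of `E` as a contraction of seminormed spaces. -/
noncomputable def localMap {p q : Seminorm ℂ E} (h : p ≤ q) : LocalSpace q →L[ℂ] LocalSpace p :=
  LinearMap.mkContinuous
    { toFun := fun x : E => (x : E)
      map_add' := fun _ _ => rfl
      map_smul' := fun _ _ => rfl } 1
    (fun x => (h x).trans_eq (one_mul (q x)).symm)

/-- For `p ≤ q`, the canonical map between the local Banach spaces of `q` and `p`. -/
noncomputable def canonicalMap {p q : Seminorm ℂ E} (h : p ≤ q) :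
    LocalBanach q →L[ℂ] LocalBanach p :=
  (localMap h).completion

variable (E) in
/-- A (complex) locally convex space is nuclear if for every continuous seminorm `p` there is a
continuous seminorm `q ≥ p` such that the canonical map between the local Banach spaces of `q`
and `p` is nuclear. -/
def IsNuclearSpace [TopologicalSpace E] [PolynormableSpace ℂ E] : Prop :=
  ∀ p : Seminorm ℂ E, Continuous p →
    ∃ q : Seminorm ℂ E, Continuous q ∧ ∃ h : p ≤ q, IsNuclearMap (canonicalMap h)

end Nuclear

/-! ### Approximate contractibility -/

section ApproximateContractibility

/-- A complex Fréchet space: a complete Hausdorff topological vector space whose topology is given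
by a countable family of seminorms. (The uniformity is the one of the additive group.) -/
class IsFrechetSpace (X : Type*) [AddCommGroup X] [Module ℂ X] [UniformSpace X] : Prop extends
    IsUniformAddGroup X, CompleteSpace X, T2Space X where
  exists_withSeminorms : ∃ q : SeminormFamily ℂ X ℕ, WithSeminorms q

/-- The structure of a Fréchet `A`-bimodule on the Fréchet space `X`, for a not necessarily unital
algebra `A`; `left a x` is `a · x` and `right x a` is `x · a`. -/
structure FrechetBimodule (A : Type*) [NonUnitalRing A] [Module ℂ A] [TopologicalSpace A]
    (X : Type*) [AddCommGroup X] [Module ℂ X] [UniformSpace X] [IsFrechetSpace X] where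
  left : A →ₗ[ℂ] X →ₗ[ℂ] X
  right : X →ₗ[ℂ] A →ₗ[ℂ] X
  left_mul : ∀ a b x, left (a * b) x = left a (left b x)
  right_mul : ∀ x a b, right x (a * b) = right (right x a) b
  left_right : ∀ a x b, right (left a x) b = left a (right x b)
  continuous_left : Continuous fun z : A × X => left z.1 z.2
  continuous_right : Continuous fun z : X × A => right z.1 z.2

/-- `D` is a derivation from `A` to the `A`-bimodule `X`. -/
def FrechetBimodule.IsDerivation {A : Type*} [NonUnitalRing A] [Module ℂ A] [TopologicalSpace A]
    {X : Type*} [AddCommGroup X] [Module ℂ X] [UniformSpace X] [IsFrechetSpace X]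
    (M : FrechetBimodule A X) (D : A →L[ℂ] X) : Prop :=
  ∀ a b, D (a * b) = M.left a (D b) + M.right (D a) b

/-- The inner derivation `a ↦ a · x - x · a`. -/
def FrechetBimodule.inner {A : Type*} [NonUnitalRing A] [Module ℂ A] [TopologicalSpace A]
    {X : Type*} [AddCommGroup X] [Module ℂ X] [UniformSpace X] [IsFrechetSpace X]
    (M : FrechetBimodule A X) (x : X) (a : A) : X :=
  M.left a x - M.right x a

/-- `A` is approximately contractible: for each Fréchet `A`-bimodule `X`, each continuous
derivation from `A` to `X` is the pointwise limit of a net of inner derivations. As neighbourhoods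
for pointwise convergence in `X` are indexed by finite subsets of `A` and natural numbers,
it is no restriction that the index sets of the nets live in the universe of `A`. -/
def IsApproximatelyContractible (A : Type v) [NonUnitalRing A] [Module ℂ A]
    [TopologicalSpace A] : Prop :=
  ∀ (X : Type u) [AddCommGroup X] [Module ℂ X] [UniformSpace X] [IsFrechetSpace X]
    (M : FrechetBimodule A X) (D : A →L[ℂ] X), M.IsDerivation D →
    ∃ (Λ : Type v) (_ : Preorder Λ) (_ : IsDirectedOrder Λ) (_ : Nonempty Λ) (x : Λ → X),
      ∀ a : A, Filter.Tendsto (fun l => M.inner (x l) a) Filter.atTop (𝓝 (D a))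

end ApproximateContractibility

/-! ### Köthe spaces and Köthe algebras -/

section KotheSpaces

variable {I : Type w}

/-- A set `P` of nonnegative functions on `I` is a Köthe set. -/
structure IsKotheSet (P : Set (I → ℝ≥0)) : Prop where
  exists_pos : ∀ i, ∃ p ∈ P, 0 < p i
  directed : ∀ p ∈ P, ∀ q ∈ P, ∃ r ∈ P, ∀ i, max (p i) (q i) ≤ r i

/-- `P` is dominated by `Q`, written `P ≺ Q`. -/
def Dominated (P Q : Set (I → ℝ≥0)) : Prop :=
  ∀ p ∈ P, ∃ q ∈ Q, ∃ C : ℝ≥0, 0 < C ∧ ∀ i, p i ≤ C * q i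

/-- Condition (B): `P ∼ P²`, where `P² = P * P` is the set of all products `p q` with
`p, q ∈ P`. -/
def ConditionB (P : Set (I → ℝ≥0)) : Prop :=
  Dominated P (P * P) ∧ Dominated (P * P) P

/-- The underlying vector space of the Köthe space `λ(P)`, as a subspace of `ℂ^I`. -/
def kotheSubmodule (P : Set (I → ℝ≥0)) : Submodule ℂ (I → ℂ) where
  carrier := {x | ∀ p ∈ P, Summable fun i => ‖x i‖ * p i}
  zero_mem' p _ := by simp
  add_mem' {x y} hx hy p hp := by
    refine Summable.of_nonneg_of_le (fun i => by positivity) (fun i => ?_)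
      ((hx p hp).add (hy p hp))
    rw [← add_mul]
    exact mul_le_mul_of_nonneg_right (norm_add_le _ _) (p i).2
  smul_mem' c x hx p hp := by
    simpa [mul_assoc] using (hx p hp).mul_left ‖c‖

/-- The Köthe space `λ(P)`. -/
def KotheSpace (P : Set (I → ℝ≥0)) : Type w := kotheSubmodule P

namespace KotheSpace

variable {P : Set (I → ℝ≥0)}

instance : AddCommGroup (KotheSpace P) := inferInstanceAs (AddCommGroup (kotheSubmodule P))

instance : Module ℂ (KotheSpace P) := inferInstanceAs (Module ℂ (kotheSubmodule P))

/-- The sequence (function on `I`) underlying an element of `λ(P)`. -/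
def coord (x : KotheSpace P) : I → ℂ := x.1

lemma summable (x : KotheSpace P) {p : I → ℝ≥0} (hp : p ∈ P) :
    Summable fun i => ‖x.coord i‖ * p i := x.2 p hp

variable (P) in
/-- The seminorms `‖x‖_p = ∑ i, |x i| p i`, for `p ∈ P`. -/
noncomputable def seminorms : SeminormFamily ℂ (KotheSpace P) P := fun p =>
  Seminorm.of (fun x => ∑' i, ‖x.coord i‖ * (p : I → ℝ≥0) i)
    (fun x y => by
      rw [← (x.summable p.2).tsum_add (y.summable p.2)]
      refine Summable.tsum_le_tsum (fun i => ?_) ((x + y).summable p.2)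
        ((x.summable p.2).add (y.summable p.2))
      rw [← add_mul]
      exact mul_le_mul_of_nonneg_right (norm_add_le (x.coord i) (y.coord i)) (p.1 i).2)
    (fun c x => by
      rw [← tsum_mul_left]
      refine tsum_congr fun i => ?_
      rw [← mul_assoc, ← norm_mul]
      rfl)

/-- The topology of `λ(P)` is the one given by the seminorms `‖·‖_p`, for `p ∈ P`. -/
noncomputable instance : TopologicalSpace (KotheSpace P) :=
  (seminorms P).moduleFilterBasis.topology

lemma withSeminorms : WithSeminorms (seminorms P) := ⟨rfl⟩

instance : PolynormableSpace ℂ (KotheSpace P) := withSeminorms.toPolynormableSpace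

end KotheSpace

/-- The set `P^× = {|x| : x ∈ λ(P)}`. -/
def kotheDualSet (P : Set (I → ℝ≥0)) : Set (I → ℝ≥0) :=
  {w | ∃ x : KotheSpace P, w = fun i => ‖x.coord i‖₊}

/-- The Köthe–Toeplitz dual `λ(P)^×`: the space of all `y` with `‖y‖_x = ∑ i, |y i x i| < ∞` for
all `x ∈ λ(P)`, with the topology given by the seminorms `‖·‖_x`. -/
abbrev KotheDual (P : Set (I → ℝ≥0)) : Type w := KotheSpace (kotheDualSet P)

/-- `P` is a Köthe set with `P ≺ P²`, i.e. `λ(P)` is a Köthe algebra. -/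
class IsKotheAlgebra (P : Set (I → ℝ≥0)) : Prop extends IsKotheSet P where
  dominated_sq : Dominated P (P * P)

namespace KotheSpace

variable {P : Set (I → ℝ≥0)}

lemma mul_mem_kotheSubmodule [hP : IsKotheAlgebra P] {x y : I → ℂ} (hx : x ∈ kotheSubmodule P)
    (hy : y ∈ kotheSubmodule P) : x * y ∈ kotheSubmodule P := by
  intro p hp
  obtain ⟨_, ⟨q, hq, r, hr, rfl⟩, C, -, hC⟩ := hP.dominated_sq p hp
  have hs : Summable fun i => ‖x i‖ * q i * (‖y i‖ * r i) := by
    have h := ((hx q hq).mul_of_nonneg (hy r hr) (fun i => by positivity)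
      (fun i => by positivity))
    exact h.comp_injective (i := fun i : I => (i, i)) (fun i j h => congrArg Prod.fst h)
  refine Summable.of_nonneg_of_le (fun i => by positivity) (fun i => ?_) (hs.mul_left (C : ℝ))
  have h : (p i : ℝ) ≤ C * (q i * r i) := by exact_mod_cast hC i
  calc ‖(x * y) i‖ * p i = ‖x i‖ * ‖y i‖ * p i := by rw [Pi.mul_apply, norm_mul]
    _ ≤ ‖x i‖ * ‖y i‖ * (C * (q i * r i)) := by gcongr
    _ = C * (‖x i‖ * q i * (‖y i‖ * r i)) := by ring

/-- Pointwise multiplication on the Köthe algebra `λ(P)`. -/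
instance [IsKotheAlgebra P] : NonUnitalCommRing (KotheSpace P) where
  mul x y := ⟨x.1 * y.1, mul_mem_kotheSubmodule x.2 y.2⟩
  left_distrib x y z := Subtype.ext (mul_add x.1 y.1 z.1)
  right_distrib x y z := Subtype.ext (add_mul x.1 y.1 z.1)
  zero_mul x := Subtype.ext (zero_mul x.1)
  mul_zero x := Subtype.ext (mul_zero x.1)
  mul_assoc x y z := Subtype.ext (mul_assoc x.1 y.1 z.1)
  mul_comm x y := Subtype.ext (mul_comm x.1 y.1)

end KotheSpace

end KotheSpaces

/-- `A²`, the linear span of all products `a b` with `a, b ∈ A`. -/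
def square (A : Type*) [NonUnitalRing A] [Module ℂ A] : Submodule ℂ A :=
  Submodule.span ℂ {c | ∃ a b : A, c = a * b}

end Kothe

/-! Every condition is compared with (iv), which says that the weights grow polynomially fast. If
log n ≤ k log p_n then n ≤ p_n^k, and P² ≺ P absorbs both powers and products, so each p ∈ P has
some r ∈ P with n² p_n ≤ C r_n (`QuadraticGrowth`). Multiplication by n² therefore preserves A. The
summable weights 1/n² then make A and its dual nuclear by the Grothendieck–Pietsch criterion, and
Cauchy–Schwarz puts √|x| in A for every x ∈ A, so x is a single product.

Conversely, it suffices to find q ∈ P with ∑ 1/q_n < ∞: monotonicity gives n ≤ S q_n for S this sum,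
hence n ≤ q_n² for almost all n. If A is nuclear, such a q comes directly from Grothendieck–Pietsch,
since all weights are at least 1. If the dual is nuclear or A = A², then √|x| is summable for every
x ∈ A, and a gliding hump argument using countability of P (`exists_summable_inv`) produces q.

For a derivation D, the partial units e_N = (1, …, 1, 0, …) form an unbounded approximate identity.
An explicit element implements D up to e_N·D(a - e_N a) + D(a - e_N a)·e_N. Quadratic growth makes
the tails of a decay faster than e_N grows, so this error vanishes by joint continuity. -/

namespace Kothe

/-! ### Unit vectors and continuous seminorms of Köthe spaces -/

namespace KotheSpace

variable {I : Type w} {P : Set (I → ℝ≥0)}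

@[ext] lemma ext {x y : KotheSpace P} (h : ∀ i, x.coord i = y.coord i) : x = y :=
  Subtype.ext (funext h)

@[simp] lemma coord_zero (i : I) : (0 : KotheSpace P).coord i = 0 := rfl

@[simp] lemma coord_sub (x y : KotheSpace P) (i : I) :
    (x - y).coord i = x.coord i - y.coord i := rfl

@[simp] lemma coord_smul (c : ℂ) (x : KotheSpace P) (i : I) :
    (c • x).coord i = c * x.coord i := rfl

@[simp] lemma coord_mul [IsKotheAlgebra P] (x y : KotheSpace P) (i : I) :
    (x * y).coord i = x.coord i * y.coord i := rfl

/-- The `i`-th coordinate as a linear functional. -/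
def coordLinear (i : I) : KotheSpace P →ₗ[ℂ] ℂ where
  toFun x := x.coord i
  map_add' _ _ := rfl
  map_smul' _ _ := rfl

@[simp] lemma coordLinear_apply (i : I) (x : KotheSpace P) : coordLinear i x = x.coord i := rfl

@[simp] lemma coord_sum {J : Type*} (s : Finset J) (f : J → KotheSpace P) (i : I) :
    (∑ j ∈ s, f j).coord i = ∑ j ∈ s, (f j).coord i :=
  map_sum (coordLinear (P := P) i) f s

lemma seminorms_apply (p : P) (x : KotheSpace P) :
    seminorms P p x = ∑' i, ‖x.coord i‖ * (p : I → ℝ≥0) i := rfl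

lemma seminorms_mono {p q : P} (h : ∀ i, p.1 i ≤ q.1 i) : seminorms P p ≤ seminorms P q :=
  fun x => (x.summable p.2).tsum_le_tsum
    (fun i => mul_le_mul_of_nonneg_left (by exact_mod_cast h i) (norm_nonneg _)) (x.summable q.2)

lemma continuous_seminorms (p : P) : Continuous (seminorms P p) :=
  withSeminorms.continuous_seminorm p

lemma norm_coord_mul_le (p : P) (x : KotheSpace P) (i : I) :
    ‖x.coord i‖ * p.1 i ≤ seminorms P p x :=
  (x.summable p.2).le_tsum i (fun _ _ => by positivity)

section Single

variable [DecidableEq I]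

/-- The `i`-th unit vector. -/
def single (P : Set (I → ℝ≥0)) (i : I) : KotheSpace P :=
  ⟨Pi.single i 1, fun p _ => summable_of_hasFiniteSupport
    ((Set.finite_singleton i).subset fun j hj => by
      by_contra h
      exact hj (by simp [Pi.single_eq_of_ne (show j ≠ i from h)]))⟩

lemma coord_single (i j : I) : (single P i).coord j = if j = i then 1 else 0 := by
  change Pi.single (M := fun _ : I => ℂ) i 1 j = _
  rw [Pi.single_apply]

lemma coord_sum_single (s : Finset I) (x : KotheSpace P) (i : I) :
    (∑ j ∈ s, x.coord j • single P j).coord i = if i ∈ s then x.coord i else 0 := by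
  simp [coord_single]

lemma seminorms_single (p : P) (i : I) : seminorms P p (single P i) = p.1 i := by
  rw [seminorms_apply, tsum_eq_single i]
  · simp [coord_single]
  · intro j hj
    simp [coord_single, hj]

lemma seminorms_sub_sum_single (p : P) (s : Finset I) (x : KotheSpace P) :
    seminorms P p (x - ∑ j ∈ s, x.coord j • single P j) =
      ∑' i : {i // i ∉ s}, ‖x.coord i‖ * p.1 i := by
  rw [seminorms_apply]
  have := tsum_subtype {i | i ∉ s} (fun i => ‖x.coord i‖ * p.1 i)
  refine Eq.trans (tsum_congr fun i => ?_) this.symm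
  rw [coord_sub, coord_sum_single]
  by_cases hi : i ∈ s <;> simp [hi]

lemma hasSum_single (x : KotheSpace P) :
    HasSum (fun i => x.coord i • single P i) x := by
  refine (withSeminorms (P := P)).tendsto_nhds _ _ |>.2 fun p ε hε => ?_
  have h := tendsto_tsum_compl_atTop_zero (fun i => ‖x.coord i‖ * p.1 i)
  filter_upwards [h.eventually (gt_mem_nhds hε)] with s hs
  rw [map_sub_rev, seminorms_sub_sum_single]
  exact hs

end Single

/-- If `P` is directed, each continuous seminorm on `λ(P)` is bounded by a multiple of one of the
defining seminorms. -/
lemma exists_le_seminorms (hne : P.Nonempty)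
    (hdir : ∀ p ∈ P, ∀ q ∈ P, ∃ r ∈ P, ∀ i, max (p i) (q i) ≤ r i) (s : Finset P) :
    ∃ p : P, s.sup (seminorms P) ≤ seminorms P p := by
  classical
  induction s using Finset.induction_on with
  | empty => exact ⟨⟨_, hne.some_mem⟩, by simp⟩
  | insert q s _ ih =>
    obtain ⟨p, hp⟩ := ih
    obtain ⟨r, hr, h⟩ := hdir q q.2 p p.2
    refine ⟨⟨r, hr⟩, ?_⟩
    rw [Finset.sup_insert]
    exact sup_le (seminorms_mono fun i => (le_max_left _ _).trans (h i))
      (hp.trans (seminorms_mono fun i => (le_max_right _ _).trans (h i)))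

lemma exists_bound_of_continuous (hne : P.Nonempty)
    (hdir : ∀ p ∈ P, ∀ q ∈ P, ∃ r ∈ P, ∀ i, max (p i) (q i) ≤ r i)
    (s : Seminorm ℂ (KotheSpace P)) (hs : Continuous s) :
    ∃ p : P, ∃ C : ℝ, 0 ≤ C ∧ ∀ x, s x ≤ C * seminorms P p x := by
  have : Nonempty P := hne.to_subtype
  obtain ⟨t, C, -, h⟩ := Seminorm.bound_of_continuous (withSeminorms (P := P)) s hs
  obtain ⟨p, hp⟩ := exists_le_seminorms hne hdir t
  exact ⟨p, C, C.2, fun x => (h x).trans (mul_le_mul_of_nonneg_left (hp x) C.2)⟩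

end KotheSpace

/-! ### The Grothendieck–Pietsch criterion -/

section GrothendieckPietsch

open KotheSpace

variable {I : Type w} {P : Set (I → ℝ≥0)}

section LocalBanach

variable {E : Type*} [AddCommGroup E] [Module ℂ E] {p q : Seminorm ℂ E}

/-- The canonical map from a space to its local Banach space at `p`. -/
noncomputable def toLocalBanach (p : Seminorm ℂ E) : E →ₗ[ℂ] LocalBanach p where
  toFun x := ((show LocalSpace p from x : LocalSpace p) : LocalBanach p)
  map_add' x y := UniformSpace.Completion.coe_add (α := LocalSpace p) x y
  map_smul' a x := UniformSpace.Completion.coe_smul (X := LocalSpace p) a x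

lemma norm_toLocalBanach (x : E) : ‖toLocalBanach p x‖ = p x :=
  UniformSpace.Completion.norm_coe (E := LocalSpace p) x

lemma LocalBanach.induction_on {motive : LocalBanach p → Prop} (z : LocalBanach p)
    (closed : IsClosed {z | motive z}) (ih : ∀ x : E, motive (toLocalBanach p x)) : motive z :=
  UniformSpace.Completion.induction_on z closed ih

lemma continuous_toLocalBanach [TopologicalSpace E] [IsTopologicalAddGroup E]
    (hp : Continuous p) : Continuous (toLocalBanach p) := by
  refine continuous_of_continuousAt_zero (toLocalBanach p) ?_
  rw [ContinuousAt, map_zero, tendsto_zero_iff_norm_tendsto_zero]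
  exact (hp.tendsto' 0 0 (map_zero p)).congr fun x => (norm_toLocalBanach x).symm

/-- A linear functional bounded by `C • p`, extended to the local Banach space of `p`. -/
noncomputable def LocalBanach.lift (f : E →ₗ[ℂ] ℂ) (C : ℝ) (h : ∀ x, ‖f x‖ ≤ C * p x) :
    LocalBanach p →L[ℂ] ℂ :=
  (LinearMap.mkContinuous (E := LocalSpace p) (F := ℂ) (σ := RingHom.id ℂ)
    { toFun := fun x : E => f x
      map_add' := fun x y => f.map_add x y
      map_smul' := fun c x => f.map_smul c x } C h).extend UniformSpace.Completion.toComplL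

lemma LocalBanach.lift_toLocalBanach (f : E →ₗ[ℂ] ℂ) (C : ℝ) (h : ∀ x, ‖f x‖ ≤ C * p x) (x : E) :
    LocalBanach.lift f C h (toLocalBanach p x) = f x :=
  ContinuousLinearMap.extend_eq (E := LocalSpace p) _
    (UniformSpace.Completion.denseRange_coe (α := LocalSpace p))
    (UniformSpace.Completion.isUniformInducing_coe (LocalSpace p)) x

lemma LocalBanach.norm_lift_le (f : E →ₗ[ℂ] ℂ) {C : ℝ} (hC : 0 ≤ C) (h : ∀ x, ‖f x‖ ≤ C * p x) :
    ‖LocalBanach.lift f C h‖ ≤ C := by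
  refine ContinuousLinearMap.opNorm_le_bound _ hC fun z => ?_
  induction z using LocalBanach.induction_on with
  | closed => exact isClosed_le (by fun_prop) (by fun_prop)
  | ih x =>
    rw [LocalBanach.lift_toLocalBanach, norm_toLocalBanach]
    exact h x

lemma canonicalMap_toLocalBanach (h : p ≤ q) (x : E) :
    canonicalMap h (toLocalBanach q x) = toLocalBanach p x :=
  UniformSpace.Completion.map_coe (localMap h).uniformContinuous _

end LocalBanach

/-- The necessity part of the Grothendieck–Pietsch criterion. -/
lemma IsNuclearSpace.exists_le_summable_mul
    (hdir : ∀ p ∈ P, ∀ q ∈ P, ∃ r ∈ P, ∀ i, max (p i) (q i) ≤ r i)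
    (hN : IsNuclearSpace (KotheSpace P)) {p : I → ℝ≥0} (hp : p ∈ P) :
    ∃ q ∈ P, ∃ c : I → ℝ, Summable c ∧ (∀ i, 0 ≤ c i) ∧ ∀ i, (p i : ℝ) ≤ c i * q i := by
  classical
  set σ := seminorms P ⟨p, hp⟩ with hσ
  obtain ⟨s, hs, hle, f, y, hfy, hsum⟩ := hN σ (continuous_seminorms ⟨p, hp⟩)
  obtain ⟨q, C, hC, hq⟩ := exists_bound_of_continuous ⟨p, hp⟩ hdir s hs
  -- The weighted coordinates p_i x_i identify the norm of the local Banach space with an ℓ¹ norm;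
  -- only ∑ |φ_i z| ≤ ‖z‖ is needed.
  let φ : I → LocalBanach σ →L[ℂ] ℂ := fun i =>
    LocalBanach.lift ((p i : ℂ) • coordLinear i) 1 fun x => by
      have := norm_coord_mul_le ⟨p, hp⟩ x i
      simpa [mul_comm] using this
  have hφ_coe (i : I) (x : KotheSpace P) : φ i (toLocalBanach σ x) = p i * x.coord i :=
    LocalBanach.lift_toLocalBanach _ _ _ _
  have hφ (F : Finset I) (z : LocalBanach σ) : ∑ i ∈ F, ‖φ i z‖ ≤ ‖z‖ := by
    induction z using LocalBanach.induction_on with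
    | closed => exact isClosed_le (by fun_prop) (by fun_prop)
    | ih x =>
      rw [norm_toLocalBanach]
      refine le_trans (le_of_eq (Finset.sum_congr rfl fun i _ => ?_))
        ((x.summable hp).sum_le_tsum F fun i _ => by positivity)
      rw [hφ_coe, norm_mul, mul_comm]
      simp
  have hφ1 (i : I) (z : LocalBanach σ) : ‖φ i z‖ ≤ ‖z‖ := by simpa using hφ {i} z
  have hsumm (i : I) : Summable fun n => ‖f n‖ * ‖φ i (y n)‖ :=
    Summable.of_nonneg_of_le (fun n => by positivity)
      (fun n => mul_le_mul_of_nonneg_left (hφ1 i _) (norm_nonneg _)) hfy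
  refine ⟨q, q.2, fun i => C * ∑' n, ‖f n‖ * ‖φ i (y n)‖, Summable.mul_left _ ?_,
    fun i => mul_nonneg hC (tsum_nonneg fun n => by positivity), fun i => ?_⟩
  · refine summable_of_sum_le (c := ∑' n, ‖f n‖ * ‖y n‖)
      (fun i => tsum_nonneg fun n => by positivity) fun F => ?_
    rw [← Summable.tsum_finsetSum fun i _ => hsumm i]
    refine (summable_sum fun i _ => hsumm i).tsum_le_tsum (fun n => ?_) hfy
    rw [← Finset.mul_sum]
    exact mul_le_mul_of_nonneg_left (hφ F _) (norm_nonneg _)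
  -- Evaluating the nuclear representation at the i-th unit vector and applying φ_i recovers the
  -- diagonal entry p_i.
  · have h1 := (hsum (toLocalBanach s (single P i))).mapL (φ i)
    rw [canonicalMap_toLocalBanach, hφ_coe] at h1
    simp only [coord_single, if_true, mul_one, map_smul, smul_eq_mul] at h1
    have h2 : ∀ n, ‖f n (toLocalBanach s (single P i)) *
        φ i (y n)‖ ≤ C * q.1 i * (‖f n‖ * ‖φ i (y n)‖) := by
      intro n
      rw [norm_mul]
      have : ‖f n (toLocalBanach s (single P i))‖ ≤
          ‖f n‖ * (C * q.1 i) := by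
        refine ((f n).le_opNorm _).trans (mul_le_mul_of_nonneg_left ?_ (norm_nonneg _))
        rw [norm_toLocalBanach]
        exact (hq _).trans_eq (by rw [seminorms_single])
      calc _ ≤ ‖f n‖ * (C * q.1 i) * ‖φ i (y n)‖ := by gcongr
        _ = _ := by ring
    have h3 := tsum_of_norm_bounded ((hsumm i).mul_left (C * (q.1 i : ℝ))).hasSum h2
    rw [h1.tsum_eq, tsum_mul_left] at h3
    calc (p i : ℝ) = ‖(p i : ℂ)‖ := by simp
      _ ≤ _ := h3
      _ = _ := by ring

/-- The sufficiency part of the Grothendieck–Pietsch criterion. -/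
lemma isNuclearSpace_of_le_summable_mul [Denumerable I] (hne : P.Nonempty)
    (hdir : ∀ p ∈ P, ∀ q ∈ P, ∃ r ∈ P, ∀ i, max (p i) (q i) ≤ r i)
    (h : ∀ p ∈ P, ∃ q ∈ P, ∃ c : I → ℝ, Summable c ∧ ∀ i, (p i : ℝ) ≤ c i * q i) :
    IsNuclearSpace (KotheSpace P) := by
  classical
  intro s hs
  obtain ⟨p, C, hC, hp⟩ := exists_bound_of_continuous hne hdir s hs
  obtain ⟨q, hqP, c, hc, hpq⟩ := h p p.2
  -- The sum dominates s itself, as the definition of nuclearity requires, and also the weighted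
  -- coordinates q_i x_i.
  set τ := s + seminorms P ⟨q, hqP⟩ with hτ
  have hle : s ≤ τ := fun x => le_add_of_nonneg_right (apply_nonneg _ x)
  refine ⟨τ, hs.add (continuous_seminorms _), hle, ?_⟩
  let f : I → LocalBanach τ →L[ℂ] ℂ := fun i =>
    LocalBanach.lift ((q i : ℂ) • coordLinear i) 1 fun x => by
      have h1 := norm_coord_mul_le ⟨q, hqP⟩ x i
      have h2 : seminorms P ⟨q, hqP⟩ x ≤ τ x := le_add_of_nonneg_left (apply_nonneg s x)
      simpa [mul_comm] using h1.trans h2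
  have hf_coe (i : I) (x : KotheSpace P) : f i (toLocalBanach τ x) = q i * x.coord i :=
    LocalBanach.lift_toLocalBanach _ _ _ _
  have hf (i : I) : ‖f i‖ ≤ 1 := LocalBanach.norm_lift_le _ zero_le_one _
  have hsingle (i : I) : s (single P i) ≤ C * (c i * q i) :=
    (hp _).trans (mul_le_mul_of_nonneg_left
      ((seminorms_single p i).le.trans (hpq i)) hC)
  let y : I → LocalBanach s := fun i => toLocalBanach s (((q i : ℂ)⁻¹) • single P i)
  have hy (i : I) : ‖y i‖ ≤ C * |c i| := by
    rw [norm_toLocalBanach, map_smul_eq_mul]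
    rcases eq_or_ne (q i) 0 with h0 | h0
    · simp [h0]; positivity
    · have h0' : (0 : ℝ) < q i := by exact_mod_cast pos_iff_ne_zero.2 h0
      have : ‖(q i : ℂ)⁻¹‖ = (q i : ℝ)⁻¹ := by simp
      rw [this, inv_mul_le_iff₀ h0']
      calc s (single P i) ≤ C * (c i * q i) := hsingle i
        _ ≤ C * (|c i| * q i) := by gcongr; exact le_abs_self _
        _ = _ := by ring
  have hfy : Summable fun i => ‖f i‖ * ‖y i‖ :=
    Summable.of_nonneg_of_le (fun i => by positivity)
      (fun i => (mul_le_of_le_one_left (norm_nonneg _) (hf i)).trans (hy i)) (hc.abs.mul_left C)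
  have hop : Summable fun i => (f i).smulRight (y i) :=
    Summable.of_norm (by simpa [ContinuousLinearMap.norm_smulRight_apply] using hfy)
  -- Both sides are continuous, so it suffices to compare them on the dense image of λ(P), using the
  -- expansion in unit vectors.
  have key : ∑' i, (f i).smulRight (y i) = canonicalMap hle := by
    ext z
    induction z using LocalBanach.induction_on with
    | closed => exact isClosed_eq (by fun_prop) (by fun_prop)
    | ih x =>
      have h1 := hop.hasSum.mapL
        (ContinuousLinearMap.apply ℂ (LocalBanach s) (toLocalBanach τ x))
      have h2 := (hasSum_single x).map (toLocalBanach s) (continuous_toLocalBanach hs)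
      rw [canonicalMap_toLocalBanach]
      refine h1.unique (h2.congr_fun fun i => ?_)
      simp only [ContinuousLinearMap.apply_apply, ContinuousLinearMap.smulRight_apply, hf_coe, y,
        Function.comp_apply, map_smul, smul_smul]
      -- Where q_i = 0 the inverse in y_i is 0 by convention; no term is lost, because s then
      -- vanishes on the i-th unit vector.
      rcases eq_or_ne (q i) 0 with h0 | h0
      · have : toLocalBanach s (single P i) = 0 := by
          rw [← norm_le_zero_iff, norm_toLocalBanach]
          simpa [h0] using hsingle i
        rw [this, smul_zero, smul_zero]
      · have h0' : (q i : ℂ) ≠ 0 := by exact_mod_cast h0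
        congr 1
        field_simp
  refine ⟨fun n => f ((Denumerable.eqv I).symm n), fun n => y ((Denumerable.eqv I).symm n),
    hfy.comp_injective (Denumerable.eqv I).symm.injective, fun z => ?_⟩
  have h1 := hop.hasSum.mapL (ContinuousLinearMap.apply ℂ (LocalBanach s) z)
  rw [key] at h1
  exact (Denumerable.eqv I).symm.hasSum_iff.2 h1

end GrothendieckPietsch

/-! ### Growth of the weights and summability of square roots -/

open KotheSpace

variable {P : Set (ℕ+ → ℝ≥0)}

lemma summable_one_div_pnat_sq : Summable fun n : ℕ+ => 1 / (n : ℝ) ^ 2 :=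
  (Real.summable_one_div_nat_pow.2 one_lt_two).comp_injective PNat.coe_injective

/-- If `P² ≺ P` and `1 ≤ p` for `p ∈ P`, the powers of elements of `P` are dominated by `P`. -/
lemma exists_pow_le (hsq : Dominated (P * P) P) (hP : ∀ p ∈ P, ∀ n, 1 ≤ p n) {p : ℕ+ → ℝ≥0}
    (hp : p ∈ P) (k : ℕ) : ∃ q ∈ P, ∃ C : ℝ≥0, ∀ n, p n ^ k ≤ C * q n := by
  induction k with
  | zero => exact ⟨p, hp, 1, fun n => by simpa using hP p hp n⟩
  | succ k ih =>
    obtain ⟨q, hq, C, h⟩ := ih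
    obtain ⟨r, hr, C', -, h'⟩ := hsq (q * p) (Set.mul_mem_mul hq hp)
    refine ⟨r, hr, C * C', fun n => ?_⟩
    calc p n ^ (k + 1) = p n ^ k * p n := pow_succ _ _
      _ ≤ C * q n * p n := by gcongr; exact h n
      _ = C * (q * p) n := by rw [Pi.mul_apply, mul_assoc]
      _ ≤ C * (C' * r n) := by gcongr; exact h' n
      _ = C * C' * r n := (mul_assoc _ _ _).symm

/-- The logarithmic growth condition gives an element of `P` of at least quadratic growth. -/
lemma exists_sq_le_of_log (hsq : Dominated (P * P) P) (hP : ∀ p ∈ P, ∀ n, 1 ≤ p n)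
    {p : ℕ+ → ℝ≥0} (hp : p ∈ P) (hfin : {n | ¬ 1 < p n}.Finite)
    (hbdd : BddAbove ((fun n : ℕ+ => Real.log n / Real.log (p n)) '' {n | 1 < p n})) :
    ∃ q ∈ P, ∃ C : ℝ≥0, ∀ n : ℕ+, (n : ℝ≥0) ^ 2 ≤ C * q n := by
  obtain ⟨M, hM⟩ := hbdd
  obtain ⟨k, hk⟩ := exists_nat_ge M
  obtain ⟨q, hq, C, h⟩ := exists_pow_le hsq hP hp (k * 2)
  -- On the finite exceptional set n² is bounded by B, which is absorbed because q ≥ 1.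
  obtain ⟨B, hB⟩ := (hfin.image fun n : ℕ+ => (n : ℝ≥0) ^ 2).bddAbove
  refine ⟨q, hq, max C B, fun n => ?_⟩
  by_cases hn : 1 < p n
  · have h1 : Real.log n ≤ k * Real.log (p n) := by
      have hlog : 0 < Real.log (p n) := Real.log_pos (by exact_mod_cast hn)
      rw [← div_le_iff₀ hlog]
      exact (hM ⟨n, hn, rfl⟩).trans hk
    have h2 : (n : ℝ) ≤ (p n : ℝ) ^ k := by
      rw [← Real.log_pow] at h1
      refine (Real.log_le_log_iff (by exact_mod_cast n.pos) ?_).1 h1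
      exact pow_pos (by exact_mod_cast zero_lt_one.trans hn) _
    have h3 : (n : ℝ≥0) ≤ p n ^ k := by exact_mod_cast h2
    calc (n : ℝ≥0) ^ 2 ≤ (p n ^ k) ^ 2 := by gcongr
      _ = p n ^ (k * 2) := (pow_mul _ _ _).symm
      _ ≤ C * q n := h n
      _ ≤ _ := by gcongr; exact le_max_left _ _
  · calc (n : ℝ≥0) ^ 2 ≤ B := hB ⟨n, hn, rfl⟩
      _ ≤ max C B * 1 := by rw [mul_one]; exact le_max_right _ _
      _ ≤ _ := by gcongr; exact hP q hq n

/-- If the inverse of some monotone `q ∈ P` is summable, `P` satisfies the logarithmic growth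
condition. -/
lemma log_of_summable_inv {q : ℕ+ → ℝ≥0} (hmono : Monotone q) (hpos : ∀ n, 1 ≤ q n)
    (hs : Summable fun n => (q n : ℝ)⁻¹) :
    {n | ¬ 1 < q n}.Finite ∧
      BddAbove ((fun n : ℕ+ => Real.log n / Real.log (q n)) '' {n | 1 < q n}) := by
  set S := ∑' n, (q n : ℝ)⁻¹ with hS
  have hpos' (n : ℕ+) : (0 : ℝ) < q n := by exact_mod_cast zero_lt_one.trans_le (hpos n)
  -- The first n terms of the series are each at least 1/q_n.
  have hnS (n : ℕ+) : (n : ℝ) ≤ S * q n := by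
    have h1 : ∑ i ∈ Finset.Icc 1 n, (q n : ℝ)⁻¹ ≤ S :=
      (Finset.sum_le_sum fun i hi => inv_anti₀ (hpos' i)
        (by exact_mod_cast hmono (Finset.mem_Icc.1 hi).2)).trans
        (hs.sum_le_tsum _ fun i _ => inv_nonneg.2 (hpos' i).le)
    rw [Finset.sum_const, nsmul_eq_mul, PNat.card_Icc] at h1
    rw [← div_le_iff₀ (hpos' n), div_eq_mul_inv]
    simpa using h1
  have hev : ∀ᶠ n in Filter.cofinite, (q n : ℝ)⁻¹ < (max S 1)⁻¹ :=
    hs.tendsto_cofinite_zero.eventually (gt_mem_nhds (by positivity))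
  have hev' : ∀ᶠ n in Filter.cofinite, max S 1 < (q n : ℝ) := by
    filter_upwards [hev] with n hn
    exact (inv_lt_inv₀ (hpos' n) (by positivity)).1 hn
  have hfin : {n | ¬ max S 1 < (q n : ℝ)}.Finite := hev'
  refine ⟨hfin.subset fun n hn hn' => hn ?_, ?_⟩
  · exact_mod_cast (le_max_right _ _).trans_lt hn'
  · obtain ⟨B, hB⟩ := (hfin.image fun n : ℕ+ => Real.log n / Real.log (q n)).bddAbove
    -- Where q_n > S one has n ≤ S q_n ≤ q_n², which gives the bound 2; B covers the finitely many
    -- other indices.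
    refine ⟨max B 2, ?_⟩
    rintro _ ⟨n, hn, rfl⟩
    by_cases h : max S 1 < (q n : ℝ)
    · refine le_trans ?_ (le_max_right _ _)
      have hlog : 0 < Real.log (q n) := Real.log_pos (by exact_mod_cast hn)
      rw [div_le_iff₀ hlog]
      calc Real.log n ≤ Real.log ((q n : ℝ) ^ 2) := by
            refine Real.log_le_log (by exact_mod_cast n.pos) ((hnS n).trans ?_)
            rw [sq]
            exact mul_le_mul_of_nonneg_right ((le_max_left _ _).trans h.le) (hpos' n).le
        _ = 2 * Real.log (q n) := by rw [Real.log_pow]; norm_num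
    · exact (hB ⟨n, h, rfl⟩).trans (le_max_left _ _)

/-- If `P` is countable and the square root of each element of `λ(P)` is summable, then some
element of `P` has a summable inverse. -/
lemma exists_summable_inv [Countable P] (hK : IsKotheSet P) (hP : ∀ p ∈ P, ∀ n, 1 ≤ p n)
    (H : ∀ x : KotheSpace P, Summable fun n => √‖x.coord n‖) :
    ∃ q ∈ P, Summable fun n => (q n : ℝ)⁻¹ := by
  by_contra! hcon
  obtain ⟨p₀, hp₀, -⟩ := hK.exists_pos 1
  have : Nonempty P := ⟨⟨p₀, hp₀⟩⟩
  obtain ⟨e, he⟩ := exists_surjective_nat P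
  choose m hmP hm using hK.directed
  -- An increasing sequence in P that is cofinal: Q_k dominates e_0, …, e_k.
  let Q : ℕ → P := fun k =>
    Nat.rec (e 0) (fun j r => ⟨m r r.2 (e (j + 1)) (e (j + 1)).2, hmP _ _ _ _⟩) k
  have hQstep (k : ℕ) (n : ℕ+) : max ((Q k).1 n) ((e (k + 1)).1 n) ≤ (Q (k + 1)).1 n :=
    hm (Q k).1 (Q k).2 (e (k + 1)).1 (e (k + 1)).2 n
  have hQmono : Monotone fun k => (Q k).1 :=
    monotone_nat_of_le_succ fun k n => (le_max_left _ _).trans (hQstep k n)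
  have hQe (k : ℕ) : (e k).1 ≤ (Q k).1 := by
    cases k with
    | zero => exact le_rfl
    | succ k => exact fun n => (le_max_right _ _).trans (hQstep k n)
  have hQ1 (k : ℕ) (n : ℕ+) : (1 : ℝ) ≤ (Q k).1 n := by exact_mod_cast hP _ (Q k).2 n
  have hQ0 (k : ℕ) (n : ℕ+) : (0 : ℝ) < (Q k).1 n := zero_lt_one.trans_le (hQ1 k n)
  -- The value 8^k is what makes √(S_k / 2^k) ≥ 2^k below.
  have hF (k : ℕ) : ∃ F : Finset ℕ+, (8 : ℝ) ^ k ≤ ∑ n ∈ F, ((Q k).1 n : ℝ)⁻¹ := by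
    by_contra! h
    exact hcon _ (Q k).2
      (summable_of_sum_le (fun n => inv_nonneg.2 (hQ0 k n).le) fun F => (h F).le)
  choose F hF using hF
  set S : ℕ → ℝ := fun k => ∑ n ∈ F k, ((Q k).1 n : ℝ)⁻¹ with hS
  have hSpos (k : ℕ) : 0 < S k := lt_of_lt_of_le (by positivity) (hF k)
  -- The hump z_k is proportional to Q_k⁻² on F_k, so both z_k Q_k and √z_k are proportional to
  -- Q_k⁻¹. The factor gives z_k the Q_k-norm 2^(-k), while ∑ √z_k = √(S_k / 2^k).
  set z : ℕ → ℕ+ → ℝ := fun k n =>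
    if n ∈ F k then (2 ^ k * S k)⁻¹ * (((Q k).1 n : ℝ)⁻¹) ^ 2 else 0 with hz
  have hz0 (k : ℕ) (n : ℕ+) : 0 ≤ z k n := by
    have := hSpos k
    simp only [hz]; split_ifs <;> positivity

  have hznorm (j k : ℕ) (hjk : j ≤ k) (G : Finset ℕ+) :
      ∑ n ∈ G, z k n * (Q j).1 n ≤ (1 / 2) ^ k := by
    calc ∑ n ∈ G, z k n * (Q j).1 n
        ≤ ∑ n ∈ G, if n ∈ F k then (2 ^ k * S k)⁻¹ * ((Q k).1 n : ℝ)⁻¹ else 0 := by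
          refine Finset.sum_le_sum fun n _ => ?_
          have hle : ((Q j).1 n : ℝ) ≤ (Q k).1 n := by exact_mod_cast hQmono hjk n
          have h0 := hQ0 k n
          have := hSpos k
          simp only [hz]
          split_ifs
          · calc _ ≤ (2 ^ k * S k)⁻¹ * (((Q k).1 n : ℝ)⁻¹) ^ 2 * (Q k).1 n := by gcongr
              _ = _ := by field_simp
          · simp
      _ ≤ ∑ n ∈ F k, (2 ^ k * S k)⁻¹ * ((Q k).1 n : ℝ)⁻¹ := by
          rw [← Finset.sum_filter]
          refine Finset.sum_le_sum_of_subset_of_nonneg (fun n hn => (Finset.mem_filter.1 hn).2)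
            fun n _ _ => ?_
          have := hSpos k; have := hQ0 k n
          positivity
      _ = (1 / 2) ^ k := by
          rw [← Finset.mul_sum]
          have := (hSpos k).ne'
          change (2 ^ k * S k)⁻¹ * S k = _
          rw [one_div, inv_pow]
          field_simp
  have hgeom : Summable fun k : ℕ => ((1 : ℝ) / 2) ^ k := summable_geometric_two
  have hzsum (n : ℕ+) : Summable fun k => z k n := by
    refine Summable.of_nonneg_of_le (fun k => hz0 k n) (fun k => ?_) hgeom
    refine le_trans ?_ (hznorm 0 k (Nat.zero_le _) {n})
    rw [Finset.sum_singleton]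
    exact le_mul_of_one_le_right (hz0 k n) (hQ1 0 n)
  set X : ℕ+ → ℝ := fun n => ∑' k, z k n with hX
  have hX0 (n : ℕ+) : 0 ≤ X n := tsum_nonneg fun k => hz0 k n
  have hXmem : (fun n => (X n : ℂ)) ∈ kotheSubmodule P := by
    intro p hp
    obtain ⟨j, hj⟩ := he ⟨p, hp⟩
    have hpj (n : ℕ+) : p n ≤ (Q j).1 n := by
      have := hQe j n
      rwa [hj] at this
    have hfin (k : ℕ) : Summable fun n => z k n * (Q j).1 n :=
      summable_of_hasFiniteSupport ((F k).finite_toSet.subset fun n hn => by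
        by_contra h
        exact hn (by simp only [hz]; rw [if_neg (mt Finset.mem_coe.2 h), zero_mul]))
    -- The geometric bound holds only for k ≥ j, hence the shift by j; the earlier humps are
    -- finitely many.
    have htail : Summable fun k => ∑' n, z k n * (Q j).1 n := by
      refine (summable_nat_add_iff j).1 (Summable.of_nonneg_of_le
        (fun k => tsum_nonneg fun n => mul_nonneg (hz0 _ n) (hQ0 j n).le) (fun k => ?_)
        ((summable_nat_add_iff j).2 hgeom))
      exact (hfin _).tsum_le_of_sum_le (hznorm j (k + j) (Nat.le_add_left _ _))
    have hQj : Summable fun n => X n * (Q j).1 n := by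
      refine summable_of_sum_le (c := ∑' k, ∑' n, z k n * (Q j).1 n)
        (fun n => mul_nonneg (hX0 n) (hQ0 j n).le) fun G => ?_
      simp only [hX, ← tsum_mul_right]
      rw [← Summable.tsum_finsetSum fun n _ => (hzsum n).mul_right _]
      refine (summable_sum fun n _ => (hzsum n).mul_right _).tsum_le_tsum (fun k => ?_) htail
      exact (hfin k).sum_le_tsum G fun n _ => mul_nonneg (hz0 _ n) (hQ0 j n).le
    refine Summable.of_nonneg_of_le (fun n => by positivity) (fun n => ?_) hQj
    rw [Complex.norm_real, Real.norm_of_nonneg (hX0 n)]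
    exact mul_le_mul_of_nonneg_left (by exact_mod_cast hpj n) (hX0 n)
  have hsqrt : Summable fun n => √(X n) := by
    refine (H ⟨_, hXmem⟩).congr fun n => ?_
    change √‖(X n : ℂ)‖ = _
    rw [Complex.norm_real, Real.norm_of_nonneg (hX0 n)]
  have hlow (k : ℕ) : (2 : ℝ) ^ k ≤ ∑' n, √(X n) := by
    have hs := hSpos k
    calc (2 : ℝ) ^ k ≤ √((2 ^ k * S k)⁻¹) * S k := by
          have : √((2 ^ k * S k)⁻¹) * S k = √(S k / 2 ^ k) := by
            nth_rewrite 2 [← Real.sqrt_sq hs.le]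
            rw [← Real.sqrt_mul (by positivity)]
            congr 1
            field_simp
          rw [this]
          refine Real.le_sqrt_of_sq_le ?_
          rw [le_div_iff₀ (by positivity)]
          calc ((2 : ℝ) ^ k) ^ 2 * 2 ^ k = 8 ^ k := by
                rw [← pow_mul, ← pow_add, show (8 : ℝ) = 2 ^ 3 by norm_num, ← pow_mul]
                congr 1; ring
            _ ≤ S k := hF k
      _ = ∑ n ∈ F k, √(z k n) := by
          simp only [hS]
          rw [Finset.mul_sum]
          refine Finset.sum_congr rfl fun n hn => ?_
          simp only [hz]
          rw [if_pos hn, Real.sqrt_mul (by positivity), Real.sqrt_sq (inv_nonneg.2 (hQ0 k n).le)]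
      _ ≤ ∑ n ∈ F k, √(X n) := Finset.sum_le_sum fun n _ =>
          Real.sqrt_le_sqrt ((hzsum n).le_tsum k fun i _ => hz0 i n)
      _ ≤ ∑' n, √(X n) := hsqrt.sum_le_tsum _ fun n _ => Real.sqrt_nonneg _
  obtain ⟨k, hk⟩ := pow_unbounded_of_one_lt (∑' n, √(X n)) (one_lt_two : (1 : ℝ) < 2)
  exact absurd (hlow k) (not_le.2 hk)

/-- Elements of `A²` have summable square roots. -/
lemma summable_sqrt_of_mem_square [IsKotheAlgebra P] (hne : P.Nonempty)
    (hP : ∀ p ∈ P, ∀ n, 1 ≤ p n) {x : KotheSpace P} (hx : x ∈ square (KotheSpace P)) :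
    Summable fun n => √‖x.coord n‖ := by
  obtain ⟨p, hp⟩ := hne
  have hl1 (a : KotheSpace P) : Summable fun n => ‖a.coord n‖ :=
    Summable.of_nonneg_of_le (fun n => norm_nonneg _)
      (fun n => le_mul_of_one_le_right (norm_nonneg _) (by exact_mod_cast hP p hp n))
      (a.summable hp)
  induction hx using Submodule.span_induction with
  | mem x h =>
    obtain ⟨a, b, rfl⟩ := h
    refine Summable.of_nonneg_of_le (fun n => Real.sqrt_nonneg _) (fun n => ?_)
      ((hl1 a).add (hl1 b))
    rw [coord_mul, norm_mul]
    refine Real.sqrt_le_iff.2 ⟨by positivity, ?_⟩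
    nlinarith [norm_nonneg (a.coord n), norm_nonneg (b.coord n)]
  | zero => simp
  | add x y _ _ hx hy =>
    refine Summable.of_nonneg_of_le (fun n => Real.sqrt_nonneg _) (fun n => ?_) (hx.add hy)
    refine Real.sqrt_le_iff.2 ⟨by positivity, (norm_add_le (x.coord n) (y.coord n)).trans ?_⟩
    rw [add_sq, Real.sq_sqrt (norm_nonneg _), Real.sq_sqrt (norm_nonneg _)]
    nlinarith [mul_nonneg (Real.sqrt_nonneg ‖x.coord n‖) (Real.sqrt_nonneg ‖y.coord n‖)]
  | smul c x _ hx =>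
    refine (hx.mul_left √‖c‖).congr fun n => ?_
    rw [coord_smul, norm_mul, Real.sqrt_mul (norm_nonneg _)]

/-- The sequence |x| + |y| again lies in λ(P) and dominates both |x| and |y|. -/
lemma kotheDualSet_directed (p : ℕ+ → ℝ≥0) (hp : p ∈ kotheDualSet P) (q : ℕ+ → ℝ≥0)
    (hq : q ∈ kotheDualSet P) : ∃ r ∈ kotheDualSet P, ∀ i, max (p i) (q i) ≤ r i := by
  obtain ⟨x, rfl⟩ := hp
  obtain ⟨y, rfl⟩ := hq
  let z : ℕ+ → ℂ := fun n => ((‖x.coord n‖ + ‖y.coord n‖ : ℝ) : ℂ)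
  have hnorm (n : ℕ+) : ‖z n‖ = ‖x.coord n‖ + ‖y.coord n‖ := by
    rw [Complex.norm_real, Real.norm_of_nonneg (by positivity)]
  have hz : z ∈ kotheSubmodule P := fun p hp => by
    refine ((x.summable hp).add (y.summable hp)).congr fun n => ?_
    rw [hnorm, add_mul]
  refine ⟨_, ⟨⟨z, hz⟩, rfl⟩, fun n => ?_⟩
  have : ‖z n‖₊ = ‖x.coord n‖₊ + ‖y.coord n‖₊ := NNReal.eq (hnorm n)
  change _ ≤ ‖z n‖₊
  rw [this]
  exact max_le (le_add_of_nonneg_right zero_le) (le_add_of_nonneg_left zero_le)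

/-- If the Köthe–Toeplitz dual is nuclear, elements of `λ(P)` have summable square roots. -/
lemma summable_sqrt_of_isNuclearSpace_kotheDual (hne : P.Nonempty) (hP : ∀ p ∈ P, ∀ n, 1 ≤ p n)
    (hN : IsNuclearSpace (KotheDual P)) (x : KotheSpace P) :
    Summable fun n => √‖x.coord n‖ := by
  obtain ⟨p, hp⟩ := hne
  obtain ⟨_, ⟨y, rfl⟩, c, hc, hc0, h⟩ :=
    hN.exists_le_summable_mul kotheDualSet_directed ⟨x, rfl⟩
  refine Summable.of_nonneg_of_le (fun n => Real.sqrt_nonneg _) (fun n => ?_)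
    (hc.add (y.summable hp))
  have h1 : ‖x.coord n‖ ≤ c n * ‖y.coord n‖ := h n
  have h2 : ‖y.coord n‖ ≤ ‖y.coord n‖ * p n :=
    le_mul_of_one_le_right (norm_nonneg _) (by exact_mod_cast hP p hp n)
  have := hc0 n
  -- From |x| ≤ c|y| one gets √|x| ≤ c + |y|, where c and y are both summable.
  refine Real.sqrt_le_iff.2 ⟨by positivity, ?_⟩
  nlinarith [norm_nonneg (y.coord n)]

/-! ### Consequences of quadratic growth -/

section QuadraticGrowth

/-- Quadratic growth of `P`: multiplication by `n ^ 2` is dominated by `P`. -/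
def QuadraticGrowth (P : Set (ℕ+ → ℝ≥0)) : Prop :=
  ∀ p ∈ P, ∃ r ∈ P, ∃ C : ℝ≥0, ∀ n : ℕ+, (n : ℝ) ^ 2 * p n ≤ C * r n

lemma quadraticGrowth_of_exists (hsq : Dominated (P * P) P)
    (h : ∃ q ∈ P, ∃ C : ℝ≥0, ∀ n : ℕ+, (n : ℝ≥0) ^ 2 ≤ C * q n) : QuadraticGrowth P := by
  obtain ⟨q, hq, C, h⟩ := h
  intro p hp
  obtain ⟨r, hr, C', -, h'⟩ := hsq (q * p) (Set.mul_mem_mul hq hp)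
  refine ⟨r, hr, C * C', fun n => ?_⟩
  have : (n : ℝ≥0) ^ 2 * p n ≤ C * C' * r n := by
    calc _ ≤ C * q n * p n := by gcongr; exact h n
      _ = C * (q * p) n := by rw [Pi.mul_apply, mul_assoc]
      _ ≤ C * (C' * r n) := by gcongr; exact h' n
      _ = C * C' * r n := (mul_assoc _ _ _).symm
  exact_mod_cast this

lemma QuadraticGrowth.summable (hQ : QuadraticGrowth P) (x : KotheSpace P) {p : ℕ+ → ℝ≥0}
    (hp : p ∈ P) : Summable fun n : ℕ+ => ‖x.coord n‖ * ((n : ℝ) ^ 2 * p n) := by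
  obtain ⟨r, hr, C, h⟩ := hQ p hp
  refine Summable.of_nonneg_of_le (fun n => by positivity) (fun n => ?_)
    ((x.summable hr).mul_left (C : ℝ))
  calc _ ≤ ‖x.coord n‖ * (C * r n) := mul_le_mul_of_nonneg_left (h n) (norm_nonneg _)
    _ = _ := by ring

lemma QuadraticGrowth.isNuclearSpace (hK : IsKotheSet P) (hQ : QuadraticGrowth P) :
    IsNuclearSpace (KotheSpace P) := by
  obtain ⟨p₀, hp₀, -⟩ := hK.exists_pos 1
  refine isNuclearSpace_of_le_summable_mul ⟨p₀, hp₀⟩ hK.directed fun p hp => ?_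
  obtain ⟨r, hr, C, h⟩ := hQ p hp
  refine ⟨r, hr, fun n => C * (1 / (n : ℝ) ^ 2), summable_one_div_pnat_sq.mul_left _, fun n => ?_⟩
  have hn : (0 : ℝ) < n := by exact_mod_cast n.pos
  have := h n
  change (p n : ℝ) ≤ C * (1 / (n : ℝ) ^ 2) * r n
  rw [mul_one_div, div_mul_eq_mul_div, le_div_iff₀ (by positivity)]
  linarith

/-- With y = n² x, again in λ(P), the weight |x| equals (1/n²)|y|, so Grothendieck–Pietsch applies
to the dual. -/
lemma QuadraticGrowth.isNuclearSpace_kotheDual (hQ : QuadraticGrowth P) :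
    IsNuclearSpace (KotheDual P) := by
  refine isNuclearSpace_of_le_summable_mul ⟨_, 0, rfl⟩ kotheDualSet_directed ?_
  rintro _ ⟨x, rfl⟩
  let y : ℕ+ → ℂ := fun n => (n : ℂ) ^ 2 * x.coord n
  have hy (n : ℕ+) : ‖y n‖ = (n : ℝ) ^ 2 * ‖x.coord n‖ := by simp [y]
  have hmem : y ∈ kotheSubmodule P := fun p hp =>
    (hQ.summable x hp).congr fun n => by rw [hy]; ring
  refine ⟨_, ⟨⟨y, hmem⟩, rfl⟩, _, summable_one_div_pnat_sq, fun n => ?_⟩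
  have hn : (0 : ℝ) < n := by exact_mod_cast n.pos
  change ‖x.coord n‖ ≤ 1 / (n : ℝ) ^ 2 * ‖y n‖
  rw [hy]
  field_simp
  exact le_rfl

/-- Each x factors as (x/√|x|)·√|x|; both factors have modulus √|x|, so only √|x| ∈ λ(P) needs
proof. -/
lemma QuadraticGrowth.square_eq_top [IsKotheAlgebra P] (hsq : Dominated (P * P) P)
    (hQ : QuadraticGrowth P) : square (KotheSpace P) = ⊤ := by
  refine Submodule.eq_top_iff'.2 fun x => Submodule.subset_span ?_
  let b : ℕ+ → ℂ := fun n => (√‖x.coord n‖ : ℝ)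
  have hb (n : ℕ+) : ‖b n‖ = √‖x.coord n‖ := by
    rw [Complex.norm_real, Real.norm_of_nonneg (Real.sqrt_nonneg _)]
  have hmem : b ∈ kotheSubmodule P := by
    intro p hp
    obtain ⟨r, hr, C, -, h⟩ := hsq (p * p) (Set.mul_mem_mul hp hp)
    refine Summable.of_nonneg_of_le (fun n => by positivity) (fun n => ?_)
      (((hQ.summable x hr).mul_left (C : ℝ)).add summable_one_div_pnat_sq)
    have hn : (0 : ℝ) < n := by exact_mod_cast n.pos
    have h1 : (p n : ℝ) * p n ≤ C * r n := by exact_mod_cast h n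
    set s := √‖x.coord n‖ with hs
    have hs2 : ‖x.coord n‖ = s ^ 2 := (Real.sq_sqrt (norm_nonneg _)).symm
    rw [hb, ← hs, hs2]
    -- Splitting off 1/n and using uv ≤ u² + v² trades the square root for the factor n² p_n², which
    -- quadratic growth and P² ≺ P control.
    calc s * p n ≤ (s * n * p n) ^ 2 + (1 / (n : ℝ)) ^ 2 := by
          have h2 : s * p n = (s * n * p n) * (1 / n) := by field_simp
          rw [h2]
          nlinarith [sq_nonneg (s * n * p n - 1 / (n : ℝ)), sq_nonneg (s * n * p n),
            sq_nonneg (1 / (n : ℝ))]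
      _ = s ^ 2 * (n : ℝ) ^ 2 * (p n * p n) + 1 / (n : ℝ) ^ 2 := by rw [one_div, inv_pow]; ring
      _ ≤ s ^ 2 * (n : ℝ) ^ 2 * (C * r n) + 1 / (n : ℝ) ^ 2 := by gcongr
      _ = _ := by ring
  let a : ℕ+ → ℂ := fun n => x.coord n / (√‖x.coord n‖ : ℝ)
  have ha (n : ℕ+) : ‖a n‖ = ‖b n‖ := by
    rw [hb, norm_div, Complex.norm_real, Real.norm_of_nonneg (Real.sqrt_nonneg _), Real.div_sqrt]
  have hmem' : a ∈ kotheSubmodule P := fun p hp =>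
    (hmem p hp).congr fun n => by rw [ha]
  refine ⟨⟨a, hmem'⟩, ⟨b, hmem⟩, KotheSpace.ext fun n => ?_⟩
  change x.coord n = x.coord n / (√‖x.coord n‖ : ℝ) * (√‖x.coord n‖ : ℝ)
  by_cases h : x.coord n = 0
  · simp [h]
  · rw [div_mul_cancel₀]
    simpa [Real.sqrt_eq_zero'] using h

end QuadraticGrowth

/-! ### Partial units as an approximate identity -/

open Filter

section PartialUnit

/-- The sum of the first `N` unit vectors. -/
def partialUnit (P : Set (ℕ+ → ℝ≥0)) (N : ℕ+) : KotheSpace P :=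
  ∑ i ∈ Finset.Icc 1 N, single P i

lemma coord_partialUnit (N i : ℕ+) : (partialUnit P N).coord i = if i ≤ N then 1 else 0 := by
  simp [partialUnit, coord_single]

lemma partialUnit_mul_eq_sum [IsKotheAlgebra P] (N : ℕ+) (a : KotheSpace P) :
    partialUnit P N * a = ∑ i ∈ Finset.Icc 1 N, a.coord i • single P i := by
  ext i
  rw [coord_mul, coord_partialUnit, coord_sum_single]
  simp

lemma partialUnit_mul_self [IsKotheAlgebra P] (N : ℕ+) :
    partialUnit P N * partialUnit P N = partialUnit P N := by
  ext i
  simp [coord_partialUnit]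

lemma single_mul [IsKotheAlgebra P] (i : ℕ+) (a : KotheSpace P) :
    single P i * a = a.coord i • single P i := by
  ext j
  rw [coord_mul, coord_smul, coord_single]
  split_ifs with h
  · rw [h]; ring
  · simp

lemma tendsto_Icc_one_atTop : Tendsto (fun N : ℕ+ => Finset.Icc 1 N) atTop atTop :=
  tendsto_atTop_finset_of_monotone (fun _ _ h => Finset.Icc_subset_Icc_right h)
    fun i => ⟨i, by simp⟩

lemma tendsto_partialUnit_mul [IsKotheAlgebra P] (a : KotheSpace P) :
    Tendsto (fun N => partialUnit P N * a) atTop (𝓝 a) := by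
  simp only [partialUnit_mul_eq_sum]
  exact (hasSum_single a).comp tendsto_Icc_one_atTop

lemma seminorms_partialUnit_le {p : P} (hmono : Monotone p.1) (N : ℕ+) :
    seminorms P p (partialUnit P N) ≤ N * p.1 N := by
  calc seminorms P p (partialUnit P N) ≤ ∑ i ∈ Finset.Icc 1 N, seminorms P p (single P i) :=
        Finset.le_sum_of_subadditive _ (map_zero _).le (map_add_le_add _) _ _
    _ ≤ ∑ i ∈ Finset.Icc 1 N, (p.1 N : ℝ) := Finset.sum_le_sum fun i hi => by
        rw [seminorms_single]
        exact_mod_cast hmono (Finset.mem_Icc.1 hi).2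
    _ = N * p.1 N := by simp

/-- Under quadratic growth, the tails of elements of `λ(P)` go to zero faster than the partial
units grow. -/
lemma QuadraticGrowth.tendsto_mul_seminorms_tail [IsKotheAlgebra P] (hsq : Dominated (P * P) P)
    (hmono : ∀ p ∈ P, Monotone p) (hQ : QuadraticGrowth P) (p : P) (a : KotheSpace P) :
    Tendsto (fun N : ℕ+ => N * p.1 N * seminorms P p (a - partialUnit P N * a)) atTop (𝓝 0) := by
  obtain ⟨r, hr, C, -, h⟩ := hsq (p.1 * p.1) (Set.mul_mem_mul p.2 p.2)
  -- Since N p_N ≤ i p_i on the tail i > N, the factor N p_N can be moved inside the sum, leaving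
  -- the tail of this convergent series.
  have hg : Summable fun i : ℕ+ => ‖a.coord i‖ * p.1 i * (i * p.1 i) := by
    refine Summable.of_nonneg_of_le (fun n => by positivity) (fun n => ?_)
      ((hQ.summable a hr).mul_left (C : ℝ))
    have hn : (1 : ℝ) ≤ n := by exact_mod_cast (one_le : 1 ≤ n)
    have h1 : (p.1 n : ℝ) * p.1 n ≤ C * r n := by exact_mod_cast h n
    calc ‖a.coord n‖ * p.1 n * (n * p.1 n) = ‖a.coord n‖ * (n * 1) * (p.1 n * p.1 n) := by ring
      _ ≤ ‖a.coord n‖ * (n * n) * (C * r n) := by gcongr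
      _ = _ := by ring
  refine squeeze_zero (fun N => by positivity) (fun N => ?_)
    ((tendsto_tsum_compl_atTop_zero fun i : ℕ+ => ‖a.coord i‖ * p.1 i * (i * p.1 i)).comp
      tendsto_Icc_one_atTop)
  rw [partialUnit_mul_eq_sum, seminorms_sub_sum_single, ← tsum_mul_left]
  refine (((a.summable p.2).subtype _).mul_left _).tsum_le_tsum (fun i => ?_) (hg.subtype _)
  have hi : N ≤ (i : ℕ+) := by
    have := i.2
    simp only [Finset.mem_Icc, one_le, true_and, not_le] at this
    exact this.le
  have h1 : (p.1 N : ℝ) ≤ p.1 i := by exact_mod_cast hmono p p.2 hi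
  have h2 : (N : ℝ) ≤ (i : ℕ+) := by exact_mod_cast hi
  calc (N : ℝ) * p.1 N * (‖a.coord i‖ * p.1 i) ≤ (i : ℕ+) * p.1 i * (‖a.coord i‖ * p.1 i) := by
        gcongr
    _ = _ := by ring

end PartialUnit

/-- A sufficient condition for `B (u l) (r l)` to converge to zero, where `B` is bilinear and
continuous at `(0, 0)`. -/
lemma tendsto_zero_of_seminorms_mul {L X : Type*} {l : Filter L} [TopologicalSpace X] [Zero X]
    (hK : IsKotheSet P) (B : KotheSpace P → KotheSpace P → X)
    (hB : ∀ (c : ℂ) (u r : KotheSpace P), c ≠ 0 → B (c • u) (c⁻¹ • r) = B u r)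
    (hB0 : Tendsto (fun z : KotheSpace P × KotheSpace P => B z.1 z.2) (𝓝 (0, 0)) (𝓝 0))
    (u r : L → KotheSpace P) (b : P → L → ℝ) (hb0 : ∀ p i, 0 < b p i)
    (hb : ∀ p i, seminorms P p (u i) ≤ b p i)
    (h : ∀ p, Tendsto (fun i => b p i * seminorms P p (r i)) l (𝓝 0)) :
    Tendsto (fun i => B (u i) (r i)) l (𝓝 0) := by
  obtain ⟨p₀, hp₀, -⟩ := hK.exists_pos 1
  refine tendsto_iff_forall_eventually_mem.2 fun V hV => ?_
  have hpre := hB0 hV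
  rw [nhds_prod_eq] at hpre
  obtain ⟨U, hU, hUV⟩ := mem_prod_same_iff.1 (mem_map.1 hpre)
  obtain ⟨⟨s, δ⟩, hδ, hsU⟩ := (withSeminorms (P := P)).hasBasis_zero_ball.mem_iff.1 hU
  obtain ⟨p, hp⟩ := exists_le_seminorms ⟨p₀, hp₀⟩ hK.directed s
  have hmem (x : KotheSpace P) (hx : seminorms P p x < δ) : x ∈ U :=
    hsU (by rw [Seminorm.mem_ball_zero]; exact (hp x).trans_lt hx)
  have hδ' : 0 < δ := hδ
  filter_upwards [(h p).eventually (gt_mem_nhds (show 0 < δ ^ 2 / 2 by positivity))] with i hi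
  have hbi := hb0 p i
  -- Bilinearity allows rescaling u by c and r by 1/c. This c brings u below δ/2, and r below δ once
  -- b·‖r‖ < δ²/2.
  have hc : 0 < δ / (2 * b p i) := by positivity
  have hnorm : ‖((δ / (2 * b p i) : ℝ) : ℂ)‖ = δ / (2 * b p i) := by
    rw [Complex.norm_real, Real.norm_of_nonneg hc.le]
  rw [← hB ((δ / (2 * b p i) : ℝ) : ℂ) (u i) (r i) (by exact_mod_cast hc.ne')]
  refine hUV (Set.mk_mem_prod (hmem _ ?_) (hmem _ ?_))
  · rw [map_smul_eq_mul, hnorm]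
    calc δ / (2 * b p i) * seminorms P p (u i) ≤ δ / (2 * b p i) * b p i := by
          gcongr; exact hb p i
      _ = δ / 2 := by field_simp
      _ < δ := by linarith
  · rw [map_smul_eq_mul, norm_inv, hnorm, inv_div]
    calc 2 * b p i / δ * seminorms P p (r i) = 2 / δ * (b p i * seminorms P p (r i)) := by ring
      _ < 2 / δ * (δ ^ 2 / 2) := by gcongr
      _ = δ := by field_simp

/-! ### Approximating derivations by inner ones -/

namespace FrechetBimodule

variable [IsKotheAlgebra P] {X : Type u} [AddCommGroup X] [Module ℂ X] [UniformSpace X]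
  [IsFrechetSpace X] (M : FrechetBimodule (KotheSpace P) X)

/-- An element of `X` implementing the derivation `D` on the span of the first `N` unit
vectors. -/
noncomputable def approximant (D : KotheSpace P →L[ℂ] X) (N : ℕ+) : X :=
  ∑ i ∈ Finset.Icc 1 N, M.left (single P i) (D (single P i)) -
    -- The bimodule need not be unital over e_N; this term corrects for the part of D(e_N) that left
    -- multiplication by e_N kills.
    (D (partialUnit P N) - M.left (partialUnit P N) (D (partialUnit P N)))

/-- The diagonal sum ∑ e_i·D(e_i) contributes e_N·D(a), and the correction term supplies the rest.
The two error terms vanish when e_N a = a. -/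
lemma inner_approximant {D : KotheSpace P →L[ℂ] X} (hD : M.IsDerivation D) (N : ℕ+)
    (a : KotheSpace P) :
    M.inner (M.approximant D N) a = D (partialUnit P N * a) +
      (M.left (partialUnit P N) (D (a - partialUnit P N * a)) +
        M.right (D (a - partialUnit P N * a)) (partialUnit P N)) := by
  set e := partialUnit P N with he
  have hee : e * e = e := partialUnit_mul_self N
  -- Since a e_i = e_i a = a_i e_i, the Leibniz rule for e_i a makes the terms a_i e_i·D(e_i)
  -- cancel.
  have h1 (i : ℕ+) : M.left a (M.left (single P i) (D (single P i))) -
      M.right (M.left (single P i) (D (single P i))) a = M.left (single P i) (D a) := by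
    have h2 : M.right (D (single P i)) a =
        D (single P i * a) - M.left (single P i) (D a) := by rw [hD]; abel
    rw [M.left_right, h2, ← M.left_mul, mul_comm a, single_mul, map_sub, ← M.left_mul, single_mul]
    simp [coord_single]
  have h3 : M.left a (∑ i ∈ Finset.Icc 1 N, M.left (single P i) (D (single P i))) -
      M.right (∑ i ∈ Finset.Icc 1 N, M.left (single P i) (D (single P i))) a = M.left e (D a) := by
    rw [map_sum, map_sum, LinearMap.sum_apply, ← Finset.sum_sub_distrib,
      Finset.sum_congr rfl fun i _ => h1 i, he, partialUnit, map_sum, LinearMap.sum_apply]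
  have h4 : M.right (D e) a = D (e * a) - M.left e (D a) := by rw [hD]; abel
  -- The Leibniz rule is applied to (a - ea)e, which is 0.
  have h5 : M.left a (D e - M.left e (D e)) = -M.right (D (a - e * a)) e := by
    have h6 : (a - e * a) * e = 0 := by rw [sub_mul, mul_comm (e * a), ← mul_assoc, hee, mul_comm,
      sub_self]
    have h7 := hD (a - e * a) e
    rw [h6, map_zero] at h7
    rw [map_sub, ← M.left_mul, ← LinearMap.sub_apply, ← map_sub, mul_comm a e]
    exact eq_neg_of_add_eq_zero_left h7.symm
  have h8 : M.right (D e - M.left e (D e)) a = D (e * a) - M.left e (D (e * a)) := by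
    rw [map_sub, LinearMap.sub_apply, M.left_right, h4, map_sub, ← M.left_mul, hee]
    abel
  rw [FrechetBimodule.inner, approximant, map_sub (M.left a), map_sub M.right, LinearMap.sub_apply,
    ← he, h5, h8]
  rw [sub_eq_iff_eq_add] at h3
  rw [h3, map_sub D, map_sub (M.left e)]
  abel

end FrechetBimodule

/-- A Köthe algebra of quadratic growth with increasing weights is approximately contractible. -/
lemma QuadraticGrowth.isApproximatelyContractible [IsKotheAlgebra P] (hK : IsKotheSet P)
    (hsq : Dominated (P * P) P) (hP : ∀ p ∈ P, ∀ n, 1 ≤ p n) (hmono : ∀ p ∈ P, Monotone p)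
    (hQ : QuadraticGrowth P) : IsApproximatelyContractible.{u} (KotheSpace P) := by
  intro X _ _ _ _ M D hD
  refine ⟨ℕ+, inferInstance, inferInstance, inferInstance, M.approximant D, fun a => ?_⟩
  simp only [M.inner_approximant hD]
  have h0 : Tendsto (fun N => D (partialUnit P N * a)) atTop (𝓝 (D a)) :=
    (D.continuous.tendsto a).comp (tendsto_partialUnit_mul a)
  have hb0 (p : P) (N : ℕ+) : (0 : ℝ) < N * p.1 N :=
    mul_pos (by exact_mod_cast N.pos) (by exact_mod_cast zero_lt_one.trans_le (hP p p.2 N))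
  have hb (p : P) (N : ℕ+) := seminorms_partialUnit_le (hmono p p.2) N
  have ht (p : P) := hQ.tendsto_mul_seminorms_tail hsq hmono p a
  have h1 := tendsto_zero_of_seminorms_mul hK (fun e x => M.left e (D x))
    (fun c e x hc => by simp [smul_smul, hc])
    ((M.continuous_left.comp (continuous_fst.prodMk (D.continuous.comp continuous_snd))).tendsto'
      _ _ (by simp)) _ _ _ hb0 hb ht
  have h2 := tendsto_zero_of_seminorms_mul hK (fun e x => M.right (D x) e)
    (fun c e x hc => by simp [smul_smul, hc])
    ((M.continuous_right.comp ((D.continuous.comp continuous_snd).prodMk continuous_fst)).tendsto'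
      _ _ (by simp)) _ _ _ hb0 hb ht
  simpa using h0.add (h1.add h2)

end Kothe

/-! ### The equivalences and approximate contractibility -/

theorem theorem7p8 (P : Set (ℕ+ → ℝ≥0)) [Kothe.IsKotheAlgebra P] (hcount : P.Countable)
    (hB : Kothe.ConditionB P) (hP : ∀ p ∈ P, ∀ n, 1 ≤ p n ∧ p n ≤ p (n + 1)) :
    List.TFAE
      [Kothe.IsNuclearSpace (Kothe.KotheSpace P),
        Kothe.IsNuclearSpace (Kothe.KotheDual P),
        Kothe.square (Kothe.KotheSpace P) = ⊤,
        ∃ p ∈ P, {n | ¬ 1 < p n}.Finite ∧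
          BddAbove ((fun n : ℕ+ => Real.log n / Real.log (p n)) '' {n | 1 < p n})] ∧
    (Kothe.IsNuclearSpace (Kothe.KotheSpace P) →
      Kothe.IsApproximatelyContractible.{u} (Kothe.KotheSpace P)) ∧
    (Kothe.IsNuclearSpace (Kothe.KotheDual P) →
      Kothe.IsApproximatelyContractible.{u} (Kothe.KotheSpace P)) ∧
    (Kothe.square (Kothe.KotheSpace P) = ⊤ →
      Kothe.IsApproximatelyContractible.{u} (Kothe.KotheSpace P)) ∧
    ((∃ p ∈ P, {n | ¬ 1 < p n}.Finite ∧
        BddAbove ((fun n : ℕ+ => Real.log n / Real.log (p n)) '' {n | 1 < p n})) →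
      Kothe.IsApproximatelyContractible.{u} (Kothe.KotheSpace P)) := by
  have hK : Kothe.IsKotheSet P := Kothe.IsKotheAlgebra.toIsKotheSet
  have : Countable P := hcount.to_subtype
  have hone : ∀ p ∈ P, ∀ n, 1 ≤ p n := fun p hp n => (hP p hp n).1
  have hmono : ∀ p ∈ P, Monotone p := fun p hp => by
    intro m n hmn
    induction n using PNat.recOn with
    | one => rw [le_antisymm hmn one_le]
    | succ n ih =>
      rcases hmn.lt_or_eq with h | h
      · exact (ih (PNat.lt_add_one_iff.1 h)).trans (hP p hp n).2
      · rw [h]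
  obtain ⟨p₀, hp₀, -⟩ := hK.exists_pos 1
  have hgrowth : (∃ p ∈ P, {n | ¬ 1 < p n}.Finite ∧
      BddAbove ((fun n : ℕ+ => Real.log n / Real.log (p n)) '' {n | 1 < p n})) →
      Kothe.QuadraticGrowth P := fun ⟨p, hp, hfin, hbdd⟩ =>
    Kothe.quadraticGrowth_of_exists hB.2 (Kothe.exists_sq_le_of_log hB.2 hone hp hfin hbdd)
  have hlog : (∃ q ∈ P, Summable fun n => (q n : ℝ)⁻¹) →
      ∃ p ∈ P, {n | ¬ 1 < p n}.Finite ∧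
        BddAbove ((fun n : ℕ+ => Real.log n / Real.log (p n)) '' {n | 1 < p n}) :=
    fun ⟨q, hq, hs⟩ => ⟨q, hq, Kothe.log_of_summable_inv (hmono q hq) (hone q hq) hs⟩
  have htfae : List.TFAE
      [Kothe.IsNuclearSpace (Kothe.KotheSpace P),
        Kothe.IsNuclearSpace (Kothe.KotheDual P),
        Kothe.square (Kothe.KotheSpace P) = ⊤,
        ∃ p ∈ P, {n | ¬ 1 < p n}.Finite ∧
          BddAbove ((fun n : ℕ+ => Real.log n / Real.log (p n)) '' {n | 1 < p n})] := by
    tfae_have 4 → 1 := fun h => (hgrowth h).isNuclearSpace hK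
    tfae_have 4 → 2 := fun h => (hgrowth h).isNuclearSpace_kotheDual
    tfae_have 4 → 3 := fun h => (hgrowth h).square_eq_top hB.2
    tfae_have 1 → 4 := fun h => by
      -- Any weight serves as p₀: from 1 ≤ p₀ ≤ c q it follows that 1/q ≤ c.
      obtain ⟨q, hq, c, hc, hc0, hle⟩ := h.exists_le_summable_mul hK.directed hp₀
      refine hlog ⟨q, hq, Summable.of_nonneg_of_le (fun n => by positivity) (fun n => ?_) hc⟩
      have hq0 : (0 : ℝ) < q n := by exact_mod_cast zero_lt_one.trans_le (hone q hq n)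
      rw [inv_le_iff_one_le_mul₀ hq0]
      exact le_trans (by exact_mod_cast hone p₀ hp₀ n) (hle n)
    tfae_have 2 → 4 := fun h => hlog <| Kothe.exists_summable_inv hK hone
      (Kothe.summable_sqrt_of_isNuclearSpace_kotheDual ⟨p₀, hp₀⟩ hone h)
    tfae_have 3 → 4 := fun h => hlog <| Kothe.exists_summable_inv hK hone fun x =>
      Kothe.summable_sqrt_of_mem_square ⟨p₀, hp₀⟩ hone (h ▸ Submodule.mem_top)
    tfae_finish
  have hcontr : (∃ p ∈ P, {n | ¬ 1 < p n}.Finite ∧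
      BddAbove ((fun n : ℕ+ => Real.log n / Real.log (p n)) '' {n | 1 < p n})) →
      Kothe.IsApproximatelyContractible.{u} (Kothe.KotheSpace P) := fun h =>
    (hgrowth h).isApproximatelyContractible hK hB.2 hone hmono
  exact ⟨htfae, fun h => hcontr ((htfae.out 0 3).1 h), fun h => hcontr ((htfae.out 1 3).1 h),
    fun h => hcontr ((htfae.out 2 3).1 h), hcontr⟩
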